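/- For integers $n\ge 1$ and $m\ge 2$, let $S(n,m)$ be the (generalized) Sierpinski graph: its vertex set is $\{0,1,\dots,m-1\}^n$, and $u,v$ are adjacent if and only if there is an $h\in\{1,\dots,n\}$ such that $u_i=v_i$ for all $i<h$, $u_h\ne v_h$, and $u_j=v_h$, $v_j=u_h$ for all $j>h$. For a graph $G=(V,E)$ and $S\subseteq V$ let $\Theta(S)$ be the set of edges with exactly one end in $S$. The bisection width $bw(G)$ of a finite graph $G$ is the minimum of $|\Theta(S)|$ over all $S\subseteq V$ for which $|S|$ and $|V\setminus S|$ differ by at most one (equivalently, over all $S$ with $|S|=\lfloor |V|/2\rfloor$). Then, for all $n\ge1$ and $m\ge2$, $$bw(S(n,m))=\begin{cases}\dfrac{m^2}{4} & \text{if } m \text{ is even},\\[2mm] n\left\lfloor\dfrac m2\right\rfloor^2+\left\lfloor\dfrac m2\right\rfloor & \text{if } m \text{ is odd.}\end{cases}$$ Moreover, this minimum is attained by the initial segment of the lexicographic order: $bw(S(n,m))=|\Theta(L)|$, where $L$ is the set of the first $\lfloor m^n/2\rfloor$ vertices of $\{0,1,\dots,m-1\}^n$ in lexicographic order. -/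

import Mathlib

/-- The generalized Sierpinski graph `S(n,m)` on the `n`-tuples over `{0, …, m-1}`:
`u` and `v` are adjacent iff for some position `h` they agree before `h`, differ at `h`,
and after `h` the tuple `u` is constantly `v h` and the tuple `v` is constantly `u h`. -/
def sierpinskiGraph (n m : ℕ) : SimpleGraph (Fin n → Fin m) where
  Adj u v := ∃ h : Fin n, (∀ i, i < h → u i = v i) ∧ u h ≠ v h ∧
    ∀ j, h < j → u j = v h ∧ v j = u h
  symm := ⟨fun _ _ ⟨h, h₁, h₂, h₃⟩ =>
    ⟨h, fun i hi => (h₁ i hi).symm, h₂.symm, fun j hj => (h₃ j hj).symm⟩⟩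
  loopless := ⟨fun _ ⟨_, _, h₂, _⟩ => h₂ rfl⟩

/-- The edge-boundary `Θ(S)`: the edges with one end in `S` and the other end outside `S`. -/
def edgeBoundary {V : Type*} (G : SimpleGraph V) (S : Set V) : Set (Sym2 V) :=
  {e | e ∈ G.edgeSet ∧ ∃ v w : V, e = s(v, w) ∧ v ∈ S ∧ w ∉ S}

/-- `S` and its complement form a bisection: their sizes differ by at most one. -/
def IsBisection {V : Type*} (S : Set V) : Prop :=
  S.ncard ≤ Sᶜ.ncard + 1 ∧ Sᶜ.ncard ≤ S.ncard + 1

/-- The bisection width of a finite graph: the least number of edges joining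
the two parts of a bisection of the vertex set. -/
noncomputable def bisectionWidth {V : Type*} [Finite V] (G : SimpleGraph V) : ℕ :=
  sInf {k | ∃ S : Set V, IsBisection S ∧ (edgeBoundary G S).ncard = k}

/-- Every finite vertex set has a bisection, so the minimum above is over a nonempty set. -/
theorem exists_isBisection (V : Type*) [Finite V] : ∃ S : Set V, IsBisection S := by
  obtain ⟨S, -, hS⟩ := Set.exists_subset_card_eq (s := (Set.univ : Set V))
    (n := Nat.card V / 2) (by rw [Set.ncard_univ]; exact Nat.div_le_self _ _)
  have := Set.ncard_add_ncard_compl S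
  exact ⟨S, by unfold IsBisection; omega⟩

/-- The number (from `1` to `m ^ n`) of a tuple in the lexicographic order, the first
coordinate being the most significant one. -/
def lexNumber {n m : ℕ} (v : Fin n → Fin m) : ℕ :=
  1 + ∑ i : Fin n, (v i : ℕ) * m ^ (n - 1 - (i : ℕ))

/-- The initial segment of the lexicographic order that consists of its first `l` tuples. -/
def lexSegment (n m l : ℕ) : Set (Fin n → Fin m) :=
  {v | lexNumber v ≤ l}

/-! `S(n+1,m)` consists of `m` copies of `S(n,m)` (blocks, given by the first letter), and any two
blocks are joined by a single edge between corners, that is, constant words. The lower bound is an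
edge-isoperimetric inequality in a form that survives induction on `n`: a side is prescribed for
every corner, and each corner on the wrong side costs 1. `terminalCost_le` bounds cut plus penalty
from below by a number depending only on the size of the set and on how many corners are prescribed
inside.

In the inductive step the blocks are sorted by decreasing share of the set. In each block the
corners facing earlier blocks are prescribed inside, and those facing later blocks outside; the
edges between blocks compensate for the resulting penalties (`sum_cross_ge`). What is left concerns
block sizes only. By `lexBoundary_add_le`, mass can be moved from the last nonempty block to the
first non-full one at no extra cost, until at most one block is partial (`exists_concentrated`).
That is the shape of an initial segment, whose cost `terminalCost_succ_le_sum` compares with the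
recursion.

If the prescription is the actual side of each corner, the penalty vanishes and `lexBoundary -
cornerCount` remains. At half size this is evaluated explicitly and agrees with the directly
computed cut of the lexicographic segment. -/

/-- The number of extreme vertices among the first `l` words of length `n`
in the lexicographic order. -/
def cornerCount (m : ℤ) : ℕ → ℤ → ℤ
  -- The empty word plays the role of all `m` corners at once.
  | 0, l => if l = 0 then 0 else m
  -- Each full block contains one corner of the whole graph; the corner of the partial block `q` is
  -- its inner corner number `q + 1`.
  | n + 1, l => l / m ^ n + if l / m ^ n + 1 ≤ cornerCount m n (l % m ^ n) then 1 else 0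

/-- The edge boundary of the first `l` words of length `n` in the lexicographic order,
with one additional outgoing edge at every extreme vertex. -/
def lexBoundary (m : ℤ) : ℕ → ℤ → ℤ
  | 0, l => if l = 0 then 0 else m
  -- Each of the `q` full blocks has `m - q` edges to the other blocks and one additional edge. An
  -- edge from a full block to an included corner of the partial block has been counted at both ends
  -- but is internal, hence the factor 2.
  | n + 1, l => l / m ^ n * (m + 1 - l / m ^ n) + lexBoundary m n (l % m ^ n)
      - 2 * min (l / m ^ n) (cornerCount m n (l % m ^ n))

/-! ### Arithmetic of the corner and boundary recursions. -/

section Numeric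

variable {m : ℤ}

lemma cornerCount_zero (n : ℕ) : cornerCount m n 0 = 0 := by
  induction n with
  | zero => simp [cornerCount]
  | succ n ih => simp [cornerCount, ih]

lemma lexBoundary_zero (n : ℕ) : lexBoundary m n 0 = 0 := by
  induction n with
  | zero => simp [lexBoundary]
  | succ n ih => simp [lexBoundary, ih, cornerCount_zero]

lemma cornerCount_full (hm : 0 < m) (n : ℕ) : cornerCount m n (m ^ n) = m := by
  cases n with
  | zero => simp [cornerCount]
  | succ n =>
    have h : m ^ (n + 1) / m ^ n = m := by
      rw [pow_succ]; exact Int.mul_ediv_cancel_left _ (by positivity)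
    have h' : m ^ (n + 1) % m ^ n = 0 := by
      rw [pow_succ]; exact Int.mul_emod_right _ _
    simp only [cornerCount, h, h', cornerCount_zero]
    split_ifs <;> omega

lemma lexBoundary_full (hm : 0 < m) (n : ℕ) : lexBoundary m n (m ^ n) = m := by
  cases n with
  | zero => simp [lexBoundary]
  | succ n =>
    have h : m ^ (n + 1) / m ^ n = m := by
      rw [pow_succ]; exact Int.mul_ediv_cancel_left _ (by positivity)
    have h' : m ^ (n + 1) % m ^ n = 0 := by
      rw [pow_succ]; exact Int.mul_emod_right _ _
    simp only [lexBoundary, h, h', lexBoundary_zero, cornerCount_zero, min_eq_right hm.le]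
    ring

lemma ediv_emod_of_lt {N q r : ℤ} (h0 : 0 ≤ r) (h1 : r < N) :
    (q * N + r) / N = q ∧ (q * N + r) % N = r := by
  constructor
  · rw [add_comm, Int.add_mul_ediv_right _ _ (by omega), Int.ediv_eq_zero_of_lt h0 h1, zero_add]
  · rw [add_comm, Int.add_mul_emod_self_right, Int.emod_eq_of_lt h0 h1]

/-- The recursion stays valid at `r = m ^ n`, where the quotient really is `q + 1`. This saves carry
distinctions for complements and for a partial block that happens to be full. -/
lemma cornerCount_succ (hm : 0 < m) (n : ℕ) {q r : ℤ} (hq0 : 0 ≤ q) (h0 : 0 ≤ r)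
    (h1 : r ≤ m ^ n) (hq : q < m ∨ r = 0) :
    cornerCount m (n + 1) (q * m ^ n + r) = q + if q + 1 ≤ cornerCount m n r then 1 else 0 := by
  have hN : 0 < m ^ n := by positivity
  rcases h1.lt_or_eq with h1 | rfl
  · obtain ⟨e1, e2⟩ := ediv_emod_of_lt (q := q) h0 h1
    simp only [cornerCount, e1, e2]
  · obtain ⟨e1, e2⟩ := ediv_emod_of_lt (q := q + 1) le_rfl hN
    have e : q * m ^ n + m ^ n = (q + 1) * m ^ n + 0 := by ring
    simp only [cornerCount, e, e1, e2, cornerCount_zero, cornerCount_full hm]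
    split_ifs <;> omega

lemma lexBoundary_succ (hm : 0 < m) (n : ℕ) {q r : ℤ} (h0 : 0 ≤ r)
    (h1 : r ≤ m ^ n) (hq0 : 0 ≤ q) (hq : q < m ∨ r = 0) :
    lexBoundary m (n + 1) (q * m ^ n + r) =
      q * (m + 1 - q) + lexBoundary m n r - 2 * min q (cornerCount m n r) := by
  have hN : 0 < m ^ n := by positivity
  rcases h1.lt_or_eq with h1 | rfl
  · obtain ⟨e1, e2⟩ := ediv_emod_of_lt (q := q) h0 h1
    simp only [lexBoundary, e1, e2]
  · obtain ⟨e1, e2⟩ := ediv_emod_of_lt (q := q + 1) le_rfl hN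
    have e : q * m ^ n + m ^ n = (q + 1) * m ^ n + 0 := by ring
    have hq' : q < m := by omega
    simp only [lexBoundary, e, e1, e2, cornerCount_zero, cornerCount_full hm, lexBoundary_zero,
      lexBoundary_full hm, min_eq_left hq'.le, min_eq_right (show 0 ≤ q + 1 by omega)]
    ring

/-- Division with remainder by `N` in the interval `[0, m * N]`. -/
lemma exists_quotient_remainder {N l : ℤ} (hN : 0 < N) (h0 : 0 ≤ l) (h1 : l ≤ m * N) :
    ∃ q r, l = q * N + r ∧ 0 ≤ q ∧ 0 ≤ r ∧ r < N ∧ (q < m ∨ q = m ∧ r = 0) := by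
  refine ⟨l / N, l % N, (Int.ediv_mul_add_emod l N).symm, Int.ediv_nonneg h0 hN.le,
    Int.emod_nonneg _ hN.ne', Int.emod_lt_of_pos _ hN, ?_⟩
  rcases h1.lt_or_eq with h | rfl
  · exact .inl (Int.ediv_lt_of_lt_mul hN h)
  · exact .inr ⟨Int.mul_ediv_cancel _ hN.ne', Int.mul_emod_left _ _⟩

lemma cornerCount_nonneg (hm : 0 < m) (n : ℕ) {l : ℤ} (h0 : 0 ≤ l) : 0 ≤ cornerCount m n l := by
  cases n with
  | zero => simp only [cornerCount]; split_ifs <;> omega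
  | succ n =>
    have : 0 ≤ l / m ^ n := Int.ediv_nonneg h0 (by positivity)
    simp only [cornerCount]; split_ifs <;> omega

lemma cornerCount_mono (hm : 0 < m) (n : ℕ) {k l : ℤ} (h0 : 0 ≤ k) (hkl : k ≤ l)
    (hl : l ≤ m ^ n) : cornerCount m n k ≤ cornerCount m n l := by
  induction n generalizing k l with
  | zero => simp only [cornerCount]; split_ifs <;> omega
  | succ n ih =>
    have hN : 0 < m ^ n := by positivity
    rw [pow_succ'] at hl
    obtain ⟨q, r, rfl, hq, hr, hrN, hqr⟩ := exists_quotient_remainder hN h0 (hkl.trans hl)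
    obtain ⟨q', r', rfl, hq', hr', hrN', hqr'⟩ := exists_quotient_remainder hN (h0.trans hkl) hl
    rw [cornerCount_succ hm n hq hr hrN.le (by omega),
      cornerCount_succ hm n hq' hr' hrN'.le (by omega)]
    rcases lt_trichotomy q q' with h | rfl | h
    · split_ifs <;> omega
    · have := ih hr (by omega) hrN'.le
      split_ifs <;> omega
    · nlinarith

lemma cornerCount_le (hm : 0 < m) (n : ℕ) {l : ℤ} (h0 : 0 ≤ l) (hl : l ≤ m ^ n) :
    cornerCount m n l ≤ m :=
  (cornerCount_mono hm n h0 hl le_rfl).trans_eq (cornerCount_full hm n)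

lemma one_le_cornerCount (hm : 0 < m) (n : ℕ) {l : ℤ} (h0 : 1 ≤ l) (hl : l ≤ m ^ n) :
    1 ≤ cornerCount m n l := by
  induction n generalizing l with
  | zero => simp only [cornerCount]; split_ifs <;> omega
  | succ n ih =>
    rw [pow_succ'] at hl
    obtain ⟨q, r, rfl, hq, hr, hrN, hqr⟩ :=
      exists_quotient_remainder (m := m) (N := m ^ n) (by positivity) (by omega) hl
    rw [cornerCount_succ hm n hq hr hrN.le (by omega)]
    rcases hq.eq_or_lt with rfl | h
    · have := ih (by omega) hrN.le
      split_ifs <;> omega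
    · split_ifs <;> omega

lemma complement_eq {N l : ℤ} (hN : 0 < N) (h0 : 0 ≤ l) (h1 : l ≤ m * N) :
    l = m * N ∨ ∃ q r, l = q * N + r ∧ m * N - l = (m - 1 - q) * N + (N - r) ∧
      0 ≤ q ∧ q < m ∧ 0 ≤ r ∧ r < N := by
  obtain ⟨q, r, rfl, hq, hr, hrN, hqr | ⟨rfl, rfl⟩⟩ := exists_quotient_remainder hN h0 h1
  · exact .inr ⟨q, r, rfl, by ring, hq, hqr, hr, hrN⟩
  · exact .inl (by ring)

/-- Replacing each letter `x` by `m - 1 - x` reverses the lexicographic order and permutes the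
corners. -/
lemma cornerCount_complement (hm : 0 < m) (n : ℕ) {l : ℤ} (h0 : 0 ≤ l) (hl : l ≤ m ^ n) :
    cornerCount m n (m ^ n - l) = m - cornerCount m n l := by
  induction n generalizing l with
  | zero => simp only [cornerCount, pow_zero] at *; split_ifs <;> omega
  | succ n ih =>
    have hfull := cornerCount_full hm (n + 1)
    rw [pow_succ'] at hl hfull ⊢
    obtain rfl | ⟨q, r, rfl, e, hq, hqm, hr, hrN⟩ := complement_eq (by positivity) h0 hl
    · rw [sub_self, cornerCount_zero, hfull, sub_self]
    · rw [e, cornerCount_succ hm n hq hr hrN.le (by omega),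
        cornerCount_succ hm n (by omega) (by omega) (by omega) (by omega), ih hr hrN.le]
      split_ifs <;> omega

/-- A set and its complement have the same true boundary `lexBoundary - cornerCount`; only the
additional edges at the corners change. -/
lemma lexBoundary_complement (hm : 0 < m) (n : ℕ) {l : ℤ} (h0 : 0 ≤ l) (hl : l ≤ m ^ n) :
    lexBoundary m n (m ^ n - l) = lexBoundary m n l + m - 2 * cornerCount m n l := by
  induction n generalizing l with
  | zero => simp only [lexBoundary, cornerCount, pow_zero] at *; split_ifs <;> omega
  | succ n ih =>
    have hfull := cornerCount_full hm (n + 1)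
    have hfull' := lexBoundary_full hm (n + 1)
    rw [pow_succ'] at hl hfull hfull' ⊢
    obtain rfl | ⟨q, r, rfl, e, hq, hqm, hr, hrN⟩ := complement_eq (by positivity) h0 hl
    · rw [sub_self, lexBoundary_zero, hfull, hfull']; ring
    · rw [e, cornerCount_succ hm n hq hr hrN.le (by omega),
        lexBoundary_succ hm n hr hrN.le hq (by omega),
        lexBoundary_succ hm n (by omega) (by omega) (by omega) (by omega), ih hr hrN.le,
        cornerCount_complement hm n hr hrN.le]
      have : (m - 1 - q) * (m + 1 - (m - 1 - q)) = q * (m + 1 - q) + 2 * m - 2 - 4 * q := by ring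
      split_ifs <;> omega

/-- Merging two initial segments of the lexicographic order saves two edges for each extreme
vertex in the smaller one. -/
lemma lexBoundary_add_le (hm : 0 < m) (n : ℕ) {k l : ℤ} (hk : 0 ≤ k) (hkl : k ≤ l)
    (h : l + k ≤ m ^ n) :
    lexBoundary m n (l + k) + 2 * cornerCount m n k ≤ lexBoundary m n l + lexBoundary m n k := by
  induction n generalizing k l with
  | zero =>
    obtain rfl : k = 0 := by simp at h; omega
    simp [lexBoundary, cornerCount]
  | succ n ih =>
    have hN : 0 < m ^ n := by positivity
    rw [pow_succ'] at h
    obtain ⟨q, r, rfl, hq, hr, hrN, hqr⟩ := exists_quotient_remainder (m := m) (l := k) hN hk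
      (by omega)
    obtain ⟨p, s, rfl, hp, hs, hsN, hps⟩ :=
      exists_quotient_remainder (m := m) (l := l) hN (by omega) (by omega)
    have hqp : q ≤ p := by
      by_contra! hc
      nlinarith
    have hqr0 : q = p → r ≤ s := by rintro rfl; omega
    have hpq : p + q ≤ m := by
      by_contra! hc
      nlinarith
    -- The product `p * q` is later generalized to an atom; these inequalities are what the linear
    -- arithmetic needs about it.
    have hprod : q = 0 ∧ p * q = 0 ∨ 1 ≤ q ∧ q ≤ p * q ∧ p ≤ p * q := by
      rcases hq.eq_or_lt with rfl | h
      · simp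
      · exact .inr ⟨h, by nlinarith, by nlinarith⟩
    have h1r := one_le_cornerCount hm n (l := r)
    have h1s := one_le_cornerCount hm n (l := s)
    have h0r := cornerCount_nonneg hm n hr
    have h0s := cornerCount_nonneg hm n hs
    rw [lexBoundary_succ hm n hr hrN.le hq (by omega),
      lexBoundary_succ hm n hs hsN.le hp (by omega), cornerCount_succ hm n hq hr hrN.le (by omega)]
    rcases lt_or_ge (s + r) (m ^ n) with hc | hc
    · have e : p * m ^ n + s + (q * m ^ n + r) = (p + q) * m ^ n + (s + r) := by ring
      have hpq' : p + q < m ∨ s + r = 0 := by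
        rcases hpq.lt_or_eq with h' | rfl
        · exact .inl h'
        · right; nlinarith
      rw [e, lexBoundary_succ hm n (by omega) hc.le (by omega) hpq']
      have hms := cornerCount_mono hm n hs (show s ≤ s + r by omega) hc.le
      have hmr := cornerCount_mono hm n hr (show r ≤ s + r by omega) hc.le
      have e2 : (p + q) * (m + 1 - (p + q)) =
        p * (m + 1 - p) + q * (m + 1 - q) - 2 * (p * q) := by ring
      rw [e2]
      have e0 : s = 0 → cornerCount m n s = 0 := by rintro rfl; exact cornerCount_zero n
      have e0' : r = 0 → cornerCount m n r = 0 := by rintro rfl; exact cornerCount_zero n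
      have key : lexBoundary m n (s + r) + 2 * min (cornerCount m n s) (cornerCount m n r) ≤
          lexBoundary m n s + lexBoundary m n r := by
        rcases le_total r s with hrs | hrs
        · have := ih hr hrs hc.le
          omega
        · have := ih hs hrs (by omega)
          rw [add_comm r s] at this
          omega
      generalize p * (m + 1 - p) = A at *
      generalize q * (m + 1 - q) = B at *
      generalize p * q = C at *
      split_ifs <;> omega
    · have e : p * m ^ n + s + (q * m ^ n + r) = (p + q + 1) * m ^ n + (s + r - m ^ n) := by ring
      have hpq' : p + q + 1 < m ∨ p + q + 1 = m ∧ s + r - m ^ n = 0 := by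
        by_contra! hcon
        rcases lt_trichotomy (p + q + 1) m with h' | h' | h'
        · omega
        · apply hcon.2 h'
          subst h'
          nlinarith
        · nlinarith
      rw [e, lexBoundary_succ hm n (by omega) (by omega) (by omega) (by omega)]
      have hms := cornerCount_mono hm n (show 0 ≤ s + r - m ^ n by omega)
        (show s + r - m ^ n ≤ s by omega) hsN.le
      have hmr := cornerCount_mono hm n (show 0 ≤ s + r - m ^ n by omega)
        (show s + r - m ^ n ≤ r by omega) hrN.le
      have e2 : (p + q + 1) * (m + 1 - (p + q + 1)) =
        p * (m + 1 - p) + q * (m + 1 - q) - 2 * (p * q) + m - 2 * p - 2 * q := by ring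
      rw [e2]
      have key : lexBoundary m n (s + r - m ^ n) + m - 2 * cornerCount m n (s + r - m ^ n)
          + 2 * cornerCount m n (min s r) ≤ lexBoundary m n s + lexBoundary m n r := by
        -- The remainders overflow one block, so induction is applied to their complements, which
        -- together fit into one block.
        have := ih (k := m ^ n - max s r) (l := m ^ n - min s r) (by omega) (by omega) (by omega)
        rw [lexBoundary_complement hm n (by omega) (by omega),
          lexBoundary_complement hm n (by omega) (by omega),
          cornerCount_complement hm n (by omega) (by omega),
          show m ^ n - min s r + (m ^ n - max s r) = m ^ n - (s + r - m ^ n) by omega,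
          lexBoundary_complement hm n (by omega) (by omega)] at this
        rcases le_total r s with hrs | hrs
        · simp only [min_eq_right hrs, max_eq_left hrs] at *
          omega
        · simp only [min_eq_left hrs, max_eq_right hrs] at *
          omega
      have hmin : cornerCount m n (min s r) = cornerCount m n s ∧ s < r ∨
          cornerCount m n (min s r) = cornerCount m n r := by
        rcases le_or_gt r s with hrs | hrs
        · right; rw [min_eq_right hrs]
        · left; rw [min_eq_left hrs.le]; exact ⟨rfl, hrs⟩
      generalize p * (m + 1 - p) = A at *
      generalize q * (m + 1 - q) = B at *
      generalize p * q = C at *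
      split_ifs <;> omega

/-! ### Cost with prescribed corners, and moving mass between two blocks. -/

/-- The edge boundary of the first `l` words of length `n` in the lexicographic order, plus the
number of extreme vertices on the wrong side when `p` of them are required to be inside. -/
def terminalCost (m : ℤ) (n : ℕ) (p l : ℤ) : ℤ :=
  lexBoundary m n l - cornerCount m n l + |p - cornerCount m n l|

lemma terminalCost_zero (n : ℕ) {p : ℤ} (hp : 0 ≤ p) : terminalCost m n p 0 = p := by
  simp [terminalCost, lexBoundary_zero, cornerCount_zero, abs_of_nonneg hp]

lemma terminalCost_full (hm : 0 < m) (n : ℕ) {p : ℤ} (hp : p ≤ m) :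
    terminalCost m n p (m ^ n) = m - p := by
  rw [terminalCost, lexBoundary_full hm, cornerCount_full hm, abs_sub_comm,
    abs_of_nonneg (by omega)]
  ring

/-- The penalty of the growing block rises by at most the gain in its corner count, which the
subtracted `cornerCount` absorbs. Emptying the other block adds at most `cornerCount m n k` to its
penalty, and the saving of `2 * cornerCount m n k` in `lexBoundary_add_le` covers this. -/
lemma terminalCost_add_le (hm : 0 < m) (n : ℕ) {k l p p' : ℤ} (hk : 0 ≤ k) (hkl : k ≤ l)
    (h : l + k ≤ m ^ n) (hp' : 0 ≤ p') :
    terminalCost m n p (l + k) + terminalCost m n p' 0 ≤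
      terminalCost m n p l + terminalCost m n p' k := by
  rw [terminalCost_zero n hp']
  have := lexBoundary_add_le hm n hk hkl h
  have := cornerCount_mono hm n (by omega) (show l ≤ l + k by omega) h
  have := cornerCount_nonneg hm n hk
  simp only [terminalCost, abs_eq_max_neg]
  omega

/-- The complementary case: the two sizes overflow one block, and it is their complements that
merge. -/
lemma terminalCost_add_sub_le (hm : 0 < m) (n : ℕ) {k l p p' : ℤ} (hkl : k ≤ l)
    (hl : l ≤ m ^ n) (h : m ^ n ≤ l + k) (hp : p ≤ m) :
    terminalCost m n p (m ^ n) + terminalCost m n p' (l + k - m ^ n) ≤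
      terminalCost m n p l + terminalCost m n p' k := by
  rw [terminalCost_full hm n hp]
  have h1 := lexBoundary_add_le hm n (k := m ^ n - l) (l := m ^ n - k)
    (by omega) (by omega) (by omega)
  rw [show m ^ n - k + (m ^ n - l) = m ^ n - (l + k - m ^ n) by ring,
    lexBoundary_complement hm n (by omega) (by omega),
    lexBoundary_complement hm n (by omega) (by omega),
    lexBoundary_complement hm n (by omega) (by omega),
    cornerCount_complement hm n (by omega) (by omega)] at h1
  have := cornerCount_mono hm n (k := l + k - m ^ n) (l := k) (by omega) (by omega) (by omega)
  have := cornerCount_le hm n (l := l) (by omega) (by omega)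
  simp only [terminalCost, abs_eq_max_neg]
  omega

end Numeric

/-! ### Concentrating the block sizes. -/

/-- Replacing a decreasing sequence of sizes by one with fewer entries strictly between `0` and
`m ^ n` does not increase the total cost. -/
lemma exists_merge {m : ℕ} (hm : 0 < m) (n : ℕ) (p l : Fin m → ℤ) (hp : ∀ i, 0 ≤ p i ∧ p i ≤ m)
    (hl : ∀ i, 0 ≤ l i ∧ l i ≤ (m : ℤ) ^ n) (hanti : Antitone l)
    (h : ∃ i j, i < j ∧ l i < (m : ℤ) ^ n ∧ 0 < l j) :
    ∃ l' : Fin m → ℤ, (∀ i, 0 ≤ l' i ∧ l' i ≤ (m : ℤ) ^ n) ∧ Antitone l' ∧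
      ∑ i, l' i = ∑ i, l i ∧
      ∑ i, terminalCost m n (p i) (l' i) ≤ ∑ i, terminalCost m n (p i) (l i) ∧
      (Finset.univ.filter fun i => 0 < l' i ∧ l' i < (m : ℤ) ^ n).card <
        (Finset.univ.filter fun i => 0 < l i ∧ l i < (m : ℤ) ^ n).card := by
  classical
  have hm' : (0 : ℤ) < m := by exact_mod_cast hm
  have hN : (0 : ℤ) < (m : ℤ) ^ n := by positivity
  obtain ⟨i₀, j₀, hij, hi₀, hj₀⟩ := h
  -- Mass moves to the first non-full block `a` from the last nonempty block `b`. All blocks before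
  -- `a` are full and all after `b` are empty, so the sequence remains decreasing.
  obtain ⟨a, ha, hamin⟩ := Finset.exists_min_image
    (Finset.univ.filter fun i => l i < (m : ℤ) ^ n) id ⟨i₀, by simpa⟩
  obtain ⟨b, hb, hbmax⟩ := Finset.exists_max_image
    (Finset.univ.filter fun i => 0 < l i) id ⟨j₀, by simpa⟩
  simp only [Finset.mem_filter, Finset.mem_univ, true_and, id] at ha hb hamin hbmax
  have hab : a < b := (hamin _ hi₀).trans_lt (hij.trans_le (hbmax _ hj₀))
  have hba := hanti hab.le
  obtain ⟨A, B, hA, hAN, hB, hBb, hAB, hcost, hex⟩ : ∃ A B, l a ≤ A ∧ A ≤ (m : ℤ) ^ n ∧ 0 ≤ B ∧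
      B ≤ l b ∧ A + B = l a + l b ∧ terminalCost m n (p a) A + terminalCost m n (p b) B ≤
      terminalCost m n (p a) (l a) + terminalCost m n (p b) (l b) ∧
      (A = (m : ℤ) ^ n ∨ B = 0) := by
    rcases le_total (l a + l b) ((m : ℤ) ^ n) with hc | hc
    · exact ⟨l a + l b, 0, by omega, hc, le_rfl, hb.le, by ring,
        terminalCost_add_le hm' n hb.le hba hc (hp b).1, .inr rfl⟩
    · exact ⟨(m : ℤ) ^ n, l a + l b - (m : ℤ) ^ n, ha.le, le_rfl, by omega, by omega, by ring,
        terminalCost_add_sub_le hm' n hba ha.le hc (hp a).2, .inl rfl⟩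
  set l' : Fin m → ℤ := fun i => if i = a then A else if i = b then B else l i with hl'
  have hl'a : l' a = A := by simp [hl']
  have hl'b : l' b = B := by simp [hl', hab.ne']
  have hl'o : ∀ i, i ≠ a → i ≠ b → l' i = l i := fun i h1 h2 => by simp [hl', h1, h2]
  have hsum : ∀ F : Fin m → ℤ → ℤ, ∑ i, F i (l' i) - ∑ i, F i (l i) =
      F a A + F b B - (F a (l a) + F b (l b)) := by
    intro F
    have hsplit : ∀ g : Fin m → ℤ, ∑ i, g i =
        g a + (g b + ∑ i ∈ (Finset.univ.erase a).erase b, g i) := by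
      intro g
      rw [Finset.add_sum_erase _ _ (by simp [hab.ne']), Finset.add_sum_erase _ _ (by simp)]
    rw [hsplit, hsplit fun i => F i (l i), hl'a, hl'b]
    rw [Finset.sum_congr rfl fun i hi => by
      rw [hl'o i (by simp at hi; tauto) (by simp at hi; tauto)]]
    ring
  refine ⟨l', ?_, ?_, ?_, ?_, ?_⟩
  · intro i
    have := hl i
    have := hl a
    have := hl b
    simp only [hl']
    split_ifs <;> omega
  · intro i j hij
    have h1 := hanti hij
    have h2 : i ≤ b → l b ≤ l i := fun h => hanti h
    have h3 : i < a → l i = (m : ℤ) ^ n := by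
      intro h
      by_contra hne
      exact absurd (hamin i (lt_of_le_of_ne (hl i).2 hne)) (not_le.2 h)
    have h4 : b < j → l j = 0 := by
      intro h
      by_contra hne
      exact absurd (hbmax j (lt_of_le_of_ne (hl j).1 (Ne.symm hne))) (not_le.2 h)
    have h5 : a ≤ j → l j ≤ l a := fun h => hanti h
    have := hl i
    have := hl j
    simp only [hl']
    split_ifs <;> omega
  · have := hsum fun _ x => x
    omega
  · have := hsum fun i x => terminalCost m n (p i) x
    omega
  · refine Finset.card_lt_card ⟨?_, ?_⟩
    · intro i
      simp only [Finset.mem_filter, Finset.mem_univ, true_and]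
      by_cases hia : i = a
      · subst hia; intro; omega
      by_cases hib : i = b
      · subst hib; intro; omega
      rw [hl'o i hia hib]; exact id
    · intro hsub
      have h1 := @hsub a
      have h2 := @hsub b
      simp only [Finset.mem_filter, Finset.mem_univ, true_and, hl'a, hl'b] at h1 h2
      omega

lemma exists_concentrated {m : ℕ} (hm : 0 < m) (n : ℕ) (p l : Fin m → ℤ)
    (hp : ∀ i, 0 ≤ p i ∧ p i ≤ m) (hl : ∀ i, 0 ≤ l i ∧ l i ≤ (m : ℤ) ^ n) (hanti : Antitone l) :
    ∃ (q : Fin m) (r : ℤ), 0 ≤ r ∧ r ≤ (m : ℤ) ^ n ∧ q * (m : ℤ) ^ n + r = ∑ i, l i ∧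
      ∑ i, terminalCost m n (p i) (if i < q then (m : ℤ) ^ n else if i = q then r else 0) ≤
        ∑ i, terminalCost m n (p i) (l i) := by
  induction hk : (Finset.univ.filter fun i => 0 < l i ∧ l i < (m : ℤ) ^ n).card
    using Nat.strong_induction_on generalizing l with
  | _ k ih =>
    by_cases h : ∃ i j, i < j ∧ l i < (m : ℤ) ^ n ∧ 0 < l j
    · obtain ⟨l', h1, h2, h3, h4, h5⟩ := exists_merge hm n p l hp hl hanti h
      obtain ⟨q, r, hr, hr', hs, hc⟩ := ih _ (hk ▸ h5) l' h1 h2 rfl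
      exact ⟨q, r, hr, hr', hs.trans h3, hc.trans h4⟩
    · push Not at h
      obtain ⟨q, hq1, hq2⟩ : ∃ q : Fin m, (∀ i < q, l i = (m : ℤ) ^ n) ∧ ∀ i, q < i → l i = 0 := by
        by_cases hfull : ∃ i, l i < (m : ℤ) ^ n
        · obtain ⟨i₀, hi₀⟩ := hfull
          obtain ⟨a, ha, hamin⟩ := Finset.exists_min_image
            (Finset.univ.filter fun i => l i < (m : ℤ) ^ n) id ⟨i₀, by simpa⟩
          simp only [Finset.mem_filter, Finset.mem_univ, true_and, id] at ha hamin
          refine ⟨a, fun i hi => ?_, fun i hi => le_antisymm (h a i hi ha) (hl i).1⟩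
          by_contra hne
          exact absurd (hamin i (lt_of_le_of_ne (hl i).2 hne)) (not_le.2 hi)
        · push Not at hfull
          -- If all blocks are full, the last one serves as the partial block, with `r = m ^ n`.
          refine ⟨⟨m - 1, by omega⟩, fun i _ => le_antisymm (hl i).2 (hfull i), fun i hi => ?_⟩
          have := i.2
          simp only [Fin.lt_def] at hi
          omega
      have hfun : l = fun i => if i < q then (m : ℤ) ^ n else if i = q then l q else 0 := by
        funext i
        split_ifs with h1 h2
        · exact hq1 i h1
        · rw [h2]
        · exact hq2 i (lt_of_le_of_ne (not_lt.1 h1) (Ne.symm h2))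
      refine ⟨q, l q, (hl q).1, (hl q).2, ?_, ?_⟩
      · conv_rhs => rw [hfun]
        rw [← Finset.sum_add_sum_compl (Finset.Iio q), Finset.sum_congr rfl
          (fun i hi => if_pos (Finset.mem_Iio.1 hi))]
        rw [Finset.sum_congr rfl (s₁ := (Finset.Iio q)ᶜ) fun i hi => if_neg (by simpa using hi)]
        simp
      · exact (Finset.sum_congr rfl fun i _ => congrArg _ (congrFun hfun i).symm).le

/-- A full block `i` with `i + z i` corners prescribed inside costs `m - i - z i`. After subtracting
`i` and the penalty `1 - z i`, the summand here remains. -/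
lemma sum_quadratic {m : ℕ} (q : Fin m) :
    ∑ i : Fin m, (if i < q then (m : ℤ) - 2 * i - 1 else 0) = q * (m - q) := by
  simp only [Fin.lt_def]
  rw [Fin.sum_univ_eq_sum_range (fun i => if i < (q : ℕ) then (m : ℤ) - 2 * i - 1 else 0) m]
  rw [← Finset.sum_filter]
  have : (Finset.range m).filter (· < (q : ℕ)) = Finset.range q := by
    ext i; simp; omega
  rw [this]
  induction (q : ℕ) with
  | zero => simp
  | succ k ih => rw [Finset.sum_range_succ, ih]; push_cast; ring

lemma terminalCost_succ_le_sum {m : ℕ} (hm : 0 < m) (n : ℕ) (z l : Fin m → ℤ)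
    (hz : ∀ i, z i = 0 ∨ z i = 1) (hl : ∀ i, 0 ≤ l i ∧ l i ≤ (m : ℤ) ^ n) (hanti : Antitone l) :
    terminalCost m (n + 1) (∑ i, z i) (∑ i, l i) ≤
      ∑ i : Fin m, (terminalCost m n (i + z i) (l i) - i) := by
  have hm' : (0 : ℤ) < m := by exact_mod_cast hm
  obtain ⟨q, r, hr, hrN, hs, hc⟩ := exists_concentrated hm n (fun i => i + z i) l
    (fun i => by have := hz i; have := i.2; omega) hl hanti
  rw [Finset.sum_sub_distrib]
  refine le_trans ?_ (sub_le_sub_right hc _)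
  rw [← Finset.sum_sub_distrib, ← hs, terminalCost,
    cornerCount_succ hm' n (by omega) hr hrN (by omega),
    lexBoundary_succ hm' n hr hrN (by omega) (by omega)]
  set κ := cornerCount m n r with hκ
  set ε : ℤ := if (q : ℤ) + 1 ≤ κ then 1 else 0 with hε
  -- Each term splits into the distance of `z i` from the actual state of the outer corner (`ε` for
  -- the partial block) and a part independent of `z`.
  have hterm : ∀ i : Fin m, terminalCost m n (i + z i)
      (if i < q then (m : ℤ) ^ n else if i = q then r else 0) - i =
      |z i - (if i < q then 1 else if i = q then ε else 0)| +
        ((if i < q then (m : ℤ) - 2 * i - 1 else 0) +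
        if i = q then lexBoundary m n r - κ + |κ - q - ε| - q else 0) := by
    intro i
    have := hz i
    have := i.2
    by_cases h1 : i < q
    · simp only [h1, h1.ne, if_true, if_false]
      rw [terminalCost_full hm' n (by omega), abs_eq_max_neg]
      omega
    · by_cases h2 : i = q
      · subst h2
        simp only [lt_irrefl, if_true, if_false, terminalCost, abs_eq_max_neg, ← hκ, hε]
        split_ifs <;> omega
      · simp only [h1, h2, if_false]
        rw [terminalCost_zero n (by omega), abs_eq_max_neg]
        omega
  rw [Finset.sum_congr rfl fun i _ => hterm i, Finset.sum_add_distrib, Finset.sum_add_distrib,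
    sum_quadratic, Finset.sum_ite_eq' Finset.univ q, if_pos (Finset.mem_univ _)]
  -- The triangle inequality replaces the individual corner mismatches by the difference of the two
  -- corner counts.
  have habs := Finset.abs_sum_le_sum_abs
    (fun i => z i - (if i < q then 1 else if i = q then ε else 0)) Finset.univ
  have hw : ∑ i : Fin m, (if i < q then (1 : ℤ) else if i = q then ε else 0) = q + ε := by
    rw [← Finset.sum_add_sum_compl (Finset.Iio q), Finset.sum_congr rfl
      (fun i hi => if_pos (Finset.mem_Iio.1 hi))]
    rw [Finset.sum_congr rfl (s₁ := (Finset.Iio q)ᶜ) fun i hi => if_neg (by simpa using hi)]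
    simp
  rw [Finset.sum_sub_distrib, hw] at habs
  have e : (q : ℤ) * (m + 1 - q) = q * (m - q) + q := by ring
  rw [e]
  generalize (q : ℤ) * (m - q) = Q at *
  have hmid : |κ - q - ε| = κ - 2 * min (q : ℤ) κ + q - ε := by
    simp only [abs_eq_max_neg, hε]; split_ifs <;> omega
  rw [hmid]
  linarith

/-! ### Block decomposition of the graph and of its cuts. -/

lemma sierpinskiGraph_adj_cons {n m : ℕ} (a b : Fin m) (u v : Fin n → Fin m) :
    (sierpinskiGraph (n + 1) m).Adj (Fin.cons a u) (Fin.cons b v) ↔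
      a = b ∧ (sierpinskiGraph n m).Adj u v ∨
        a ≠ b ∧ u = Function.const _ b ∧ v = Function.const _ a := by
  constructor
  · rintro ⟨h, h1, h2, h3⟩
    cases h using Fin.cases with
    | zero =>
      refine .inr ⟨by simpa using h2, ?_, ?_⟩ <;> funext j
      · simpa using (h3 j.succ (Fin.succ_pos j)).1
      · simpa using (h3 j.succ (Fin.succ_pos j)).2
    | succ h =>
      refine .inl ⟨by simpa using h1 0 (Fin.succ_pos h), h, fun i hi => ?_, by simpa using h2,
        fun j hj => ?_⟩
      · simpa using h1 i.succ (Fin.succ_lt_succ_iff.2 hi)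
      · simpa using h3 j.succ (Fin.succ_lt_succ_iff.2 hj)
  · rintro (⟨rfl, h, h1, h2, h3⟩ | ⟨hab, rfl, rfl⟩)
    · refine ⟨h.succ, fun i hi => ?_, by simpa using h2, fun j hj => ?_⟩
      · cases i using Fin.cases with
        | zero => simp
        | succ i => simpa using h1 i (Fin.succ_lt_succ_iff.1 hi)
      · cases j using Fin.cases with
        | zero => exact absurd hj (Fin.not_lt_zero _)
        | succ j => simpa using h3 j (Fin.succ_lt_succ_iff.1 hj)
    · refine ⟨0, fun i hi => absurd hi (Fin.not_lt_zero _), by simpa using hab, fun j hj => ?_⟩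
      cases j using Fin.cases with
      | zero => exact absurd hj (lt_irrefl _)
      | succ j => simp

lemma sum_cons {n m : ℕ} (F : (Fin (n + 1) → Fin m) → ℤ) :
    ∑ u, F u = ∑ a, ∑ w : Fin n → Fin m, F (Fin.cons a w) := by
  rw [← Fintype.sum_prod_type' fun a w => F (Fin.cons a w)]
  exact (Fintype.sum_equiv (Fin.consEquiv fun _ => Fin m) _ _ fun _ => rfl).symm

open Classical in
/-- The number of edges from the set with indicator function `f` to its complement. -/
noncomputable def cutWeight (n m : ℕ) (f : (Fin n → Fin m) → ℤ) : ℤ :=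
  ∑ u, ∑ v, if (sierpinskiGraph n m).Adj u v then f u * (1 - f v) else 0

lemma cutWeight_zero (m : ℕ) (f : (Fin 0 → Fin m) → ℤ) : cutWeight 0 m f = 0 := by
  refine Finset.sum_eq_zero fun u _ => Finset.sum_eq_zero fun v _ => if_neg ?_
  rintro ⟨h, -⟩
  exact h.elim0

lemma cutWeight_succ (n m : ℕ) (f : (Fin (n + 1) → Fin m) → ℤ) :
    cutWeight (n + 1) m f = ∑ a, cutWeight n m (fun w => f (Fin.cons a w)) +
      ∑ a, ∑ b, if a = b then 0 else
        f (Fin.cons a (Function.const _ b)) * (1 - f (Fin.cons b (Function.const _ a))) := by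
  classical
  simp only [cutWeight]
  rw [sum_cons, ← Finset.sum_add_distrib]
  refine Finset.sum_congr rfl fun a _ => ?_
  simp_rw [sum_cons]
  rw [Finset.sum_comm]
  have h : ∀ b, ∑ u : Fin n → Fin m, ∑ v : Fin n → Fin m,
      (if (sierpinskiGraph (n + 1) m).Adj (Fin.cons a u) (Fin.cons b v) then
        f (Fin.cons a u) * (1 - f (Fin.cons b v)) else 0) =
      (if a = b then ∑ u : Fin n → Fin m, ∑ v : Fin n → Fin m,
        if (sierpinskiGraph n m).Adj u v then f (Fin.cons a u) * (1 - f (Fin.cons a v)) else 0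
        else 0) +
      if a = b then 0 else
        f (Fin.cons a (Function.const _ b)) * (1 - f (Fin.cons b (Function.const _ a))) := by
    intro b
    by_cases hab : a = b
    · subst hab
      simp [sierpinskiGraph_adj_cons]
    · simp only [sierpinskiGraph_adj_cons, hab, false_and, false_or, ne_eq, not_false_eq_true,
        true_and, if_false, zero_add]
      rw [Finset.sum_eq_single (Function.const _ b), Finset.sum_eq_single (Function.const _ a)]
      · simp
      · intro v _ hv; simp [hv]
      · simp
      · intro u _ hu; simp [hu]
      · simp
  rw [Finset.sum_congr rfl fun b _ => h b, Finset.sum_add_distrib]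
  simp

/-! ### The isoperimetric inequality. -/

/-- In any ordering of the blocks, a pair of blocks contributes at least the amount by which
the earlier one exceeds the later one at their common edge. -/
lemma sum_cross_ge {m : ℕ} (y : Fin m → Fin m → ℤ) (hy : ∀ i j, y i j = 0 ∨ y i j = 1) :
    ∑ i : Fin m, (∑ j, (if i = j then 0 else |y i j - if j < i then 1 else 0|) - i) ≤
      ∑ i, ∑ j, if i = j then 0 else y i j * (1 - y j i) := by
  have hi : ∀ i : Fin m, (i : ℤ) = ∑ j : Fin m, if j < i then 1 else 0 := by
    intro i
    rw [Finset.sum_boole]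
    have : Finset.univ.filter (fun j : Fin m => j < i) = Finset.Iio i := by ext; simp
    rw [this, Fin.card_Iio]
  -- For `i < j` the two mismatches are `y i j` and `1 - y j i`; the subtracted 1 per pair is what
  -- the terms `- i` add up to.
  have key : ∑ i, ∑ j, ((if i = j then 0 else |y i j - if j < i then 1 else 0|) -
      if j < i then 1 else 0) = ∑ i, ∑ j, if i < j then y i j - y j i else 0 := by
    have h1 : ∀ i j : Fin m, ((if i = j then 0 else |y i j - if j < i then 1 else 0|) -
        if j < i then 1 else 0) = (if i < j then y i j else 0) - if j < i then y i j else 0 := by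
      intro i j
      have := hy i j
      rcases lt_trichotomy i j with h | rfl | h
      · simp only [h, h.ne, h.not_gt, if_true, if_false, abs_eq_max_neg]; omega
      · simp
      · simp only [h, h.ne', h.not_gt, if_true, if_false, abs_eq_max_neg]; omega
    have h2 : ∀ i j : Fin m, (if i < j then y i j - y j i else 0) =
        (if i < j then y i j else 0) - if i < j then y j i else 0 := by
      intro i j; split_ifs <;> ring
    simp_rw [h1, h2, Finset.sum_sub_distrib]
    rw [Finset.sum_comm (f := fun i j => if i < j then y j i else 0)]
  have hsym : ∑ i, ∑ j, (if i = j then 0 else y i j * (1 - y j i)) =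
      ∑ i, ∑ j, if i < j then y i j * (1 - y j i) + y j i * (1 - y i j) else 0 := by
    have h1 : ∀ i j : Fin m, (if i = j then 0 else y i j * (1 - y j i)) =
        (if i < j then y i j * (1 - y j i) else 0) + if j < i then y i j * (1 - y j i) else 0 := by
      intro i j
      rcases lt_trichotomy i j with h | rfl | h
      · simp [h, h.ne, h.not_gt]
      · simp
      · simp [h, h.ne', h.not_gt]
    have h2 : ∀ i j : Fin m, (if i < j then y i j * (1 - y j i) + y j i * (1 - y i j) else 0) =
        (if i < j then y i j * (1 - y j i) else 0) + if i < j then y j i * (1 - y i j) else 0 := by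
      intro i j; split_ifs <;> ring
    simp_rw [h1, h2, Finset.sum_add_distrib]
    rw [Finset.sum_comm (f := fun i j => if i < j then y j i * (1 - y i j) else 0)]
  simp_rw [hi, ← Finset.sum_sub_distrib]
  rw [key, hsym]
  refine Finset.sum_le_sum fun i _ => Finset.sum_le_sum fun j _ => ?_
  split_ifs
  · rcases hy i j with h | h <;> rcases hy j i with h' | h' <;> simp [h, h']
  · rfl

/-- Edges leave a block only at its corners, and `z` records the side assumed for their outer ends;
with this freedom the statement can be applied to each block separately. -/
theorem terminalCost_le {m : ℕ} (hm : 0 < m) (n : ℕ) (f : (Fin n → Fin m) → ℤ)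
    (hf : ∀ u, f u = 0 ∨ f u = 1) (z : Fin m → ℤ) (hz : ∀ c, z c = 0 ∨ z c = 1) :
    terminalCost m n (∑ c, z c) (∑ u, f u) ≤
      cutWeight n m f + ∑ c, |f (Function.const _ c) - z c| := by
  induction n generalizing z with
  | zero =>
    rw [cutWeight_zero, Fintype.sum_unique f]
    have hz0 : 0 ≤ ∑ c, z c := Finset.sum_nonneg fun c _ => by have := hz c; omega
    have hz1 : ∑ c, z c ≤ m := (Finset.sum_le_card_nsmul _ _ 1 fun c _ => by
      have := hz c; omega).trans (by simp)
    simp_rw [Subsingleton.elim (Function.const (Fin 0) _) (default : Fin 0 → Fin m)]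
    rcases hf default with h | h <;> rw [h]
    · rw [terminalCost_zero 0 hz0, zero_add]
      refine Finset.sum_le_sum fun c _ => ?_
      have := hz c
      rw [abs_eq_max_neg]; omega
    · have := terminalCost_full (m := m) (by exact_mod_cast hm) 0 hz1
      rw [pow_zero] at this
      rw [this, zero_add]
      have h1 : ∀ c, |1 - z c| = 1 - z c := fun c => abs_of_nonneg (by have := hz c; omega)
      simp [h1]
  | succ n ih =>
    set s : Fin m → ℤ := fun a => ∑ w : Fin n → Fin m, f (Fin.cons a w) with hs
    -- The negation makes the sorted block sizes decreasing.
    set σ : Equiv.Perm (Fin m) := Tuple.sort fun a => - s a with hσ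
    have hanti : Antitone fun i => s (σ i) := by
      have := Tuple.monotone_sort fun a => - s a
      intro i j hij
      have := this hij
      simpa using this
    have hsl : ∀ i, 0 ≤ s (σ i) ∧ s (σ i) ≤ (m : ℤ) ^ n := by
      intro i
      constructor
      · exact Finset.sum_nonneg fun w _ => by have := hf (Fin.cons (σ i) w); omega
      · refine (Finset.sum_le_card_nsmul _ _ 1 fun w _ => ?_).trans (by simp)
        have := hf (Fin.cons (σ i) w); omega
    have hmain := terminalCost_succ_le_sum hm n (fun i => z (σ i)) (fun i => s (σ i))
      (fun i => hz _) hsl hanti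
    rw [Equiv.sum_comp σ z, Equiv.sum_comp σ s] at hmain
    rw [sum_cons]
    refine hmain.trans ?_
    set x : Fin m → Fin m → ℤ := fun a b => f (Fin.cons a (Function.const _ b)) with hx
    have hblock : ∀ i : Fin m, terminalCost m n (i + z (σ i)) (s (σ i)) ≤
        cutWeight n m (fun w => f (Fin.cons (σ i) w)) +
          (∑ j, (if i = j then 0 else |x (σ i) (σ j) - if j < i then 1 else 0|) +
            |x (σ i) (σ i) - z (σ i)|) := by
      intro i
      have := ih (fun w => f (Fin.cons (σ i) w)) (fun _ => hf _)
        -- The own corner keeps its prescription; a corner facing another block is prescribed inside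
        -- exactly when that block comes earlier in the order.
        (fun c => if c = σ i then z c else if σ.symm c < i then 1 else 0)
        (fun c => by have := hz c; split_ifs <;> omega)
      rw [← Equiv.sum_comp σ, ← Equiv.sum_comp σ (fun c => |_|)] at this
      have e1 : ∑ j, (if σ j = σ i then z (σ j) else if σ.symm (σ j) < i then 1 else 0) =
          (i : ℤ) + z (σ i) := by
        have : ∀ j, (if σ j = σ i then z (σ j) else if σ.symm (σ j) < i then 1 else 0) =
            (if j < i then 1 else 0) + if j = i then z (σ i) else 0 := by
          intro j
          by_cases h : j = i
          · subst h; simp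
          · simp [h]
        simp_rw [this, Finset.sum_add_distrib, Finset.sum_boole]
        have : Finset.univ.filter (fun j : Fin m => j < i) = Finset.Iio i := by ext; simp
        simp [this, Fin.card_Iio]
      have e2 : ∑ j, |f (Fin.cons (σ i) (Function.const _ (σ j))) -
          (if σ j = σ i then z (σ j) else if σ.symm (σ j) < i then 1 else 0)| =
          ∑ j, (if i = j then 0 else |x (σ i) (σ j) - if j < i then 1 else 0|) +
            |x (σ i) (σ i) - z (σ i)| := by
        have : ∀ j, |f (Fin.cons (σ i) (Function.const _ (σ j))) -
            (if σ j = σ i then z (σ j) else if σ.symm (σ j) < i then 1 else 0)| =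
            (if i = j then 0 else |x (σ i) (σ j) - if j < i then 1 else 0|) +
              if j = i then |x (σ i) (σ i) - z (σ i)| else 0 := by
          intro j
          by_cases h : j = i
          · subst h; simp [hx]
          · simp [h, Ne.symm h, hx]
        simp_rw [this, Finset.sum_add_distrib]
        simp
      rw [e1, e2] at this
      exact this
    have hcross := sum_cross_ge (fun i j => x (σ i) (σ j)) (fun i j => hf _)
    have hcross' : ∑ i, ∑ j, (if i = j then 0 else x (σ i) (σ j) * (1 - x (σ j) (σ i))) =
        ∑ a, ∑ b, if a = b then 0 else x a b * (1 - x b a) := by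
      rw [← Equiv.sum_comp σ fun a => ∑ b, if a = b then 0 else x a b * (1 - x b a)]
      refine Finset.sum_congr rfl fun i _ => ?_
      rw [← Equiv.sum_comp σ fun b => if σ i = b then 0 else x (σ i) b * (1 - x b (σ i))]
      simp
    have hconst : ∀ c : Fin m, Function.const (Fin (n + 1)) c =
        Fin.cons c (Function.const (Fin n) c) := by
      intro c; funext i; cases i using Fin.cases <;> simp
    rw [cutWeight_succ]
    simp_rw [hconst]
    have hsum := Finset.sum_le_sum fun i (_ : i ∈ Finset.univ) => hblock i
    rw [Finset.sum_add_distrib, Finset.sum_add_distrib,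
      Equiv.sum_comp σ fun a => cutWeight n m fun w => f (Fin.cons a w),
      Equiv.sum_comp σ fun a => |x a a - z a|] at hsum
    rw [hcross', Finset.sum_sub_distrib] at hcross
    rw [Finset.sum_sub_distrib]
    simp only [hx] at *
    linarith

/-! ### Edge boundaries as sums, and the cut of an initial segment. -/

open Classical in
lemma ncard_edgeBoundary {V : Type*} [Fintype V] (G : SimpleGraph V) (S : Set V) :
    ((edgeBoundary G S).ncard : ℤ) = ∑ u, ∑ v, if G.Adj u v then
      (if u ∈ S then (1 : ℤ) else 0) * (1 - if v ∈ S then 1 else 0) else 0 := by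
  have himage : edgeBoundary G S = (fun p : V × V => s(p.1, p.2)) ''
      {p | G.Adj p.1 p.2 ∧ p.1 ∈ S ∧ p.2 ∉ S} := by
    ext e
    constructor
    · rintro ⟨he, v, w, rfl, hv, hw⟩
      exact ⟨(v, w), ⟨he, hv, hw⟩, rfl⟩
    · rintro ⟨⟨v, w⟩, ⟨ha, hv, hw⟩, rfl⟩
      exact ⟨ha, v, w, rfl, hv, hw⟩
  -- A boundary edge has only one orientation leading out of `S`, so counting ordered pairs counts
  -- it once.
  have hinj : Set.InjOn (fun p : V × V => s(p.1, p.2))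
      {p | G.Adj p.1 p.2 ∧ p.1 ∈ S ∧ p.2 ∉ S} := by
    rintro ⟨u, v⟩ ⟨-, hu, hv⟩ ⟨u', v'⟩ ⟨-, hu', hv'⟩ h
    simp only [Sym2.eq_iff] at h
    rcases h with ⟨rfl, rfl⟩ | ⟨rfl, rfl⟩
    · rfl
    · exact absurd hu hv'
  rw [himage, hinj.ncard_image, Set.ncard_eq_toFinset_card', ← Fintype.sum_prod_type',
    Set.toFinset_ofPred, Finset.card_filter]
  push_cast
  refine Finset.sum_congr rfl fun p _ => ?_
  by_cases h1 : G.Adj p.1 p.2 <;> by_cases h2 : p.1 ∈ S <;> by_cases h3 : p.2 ∈ S <;>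
    simp [h1, h2, h3]

open Classical in
lemma ncard_eq_sum {V : Type*} [Fintype V] (S : Set V) :
    (S.ncard : ℤ) = ∑ u, if u ∈ S then (1 : ℤ) else 0 := by
  rw [Set.ncard_eq_toFinset_card', Finset.sum_boole]
  congr 2
  ext; simp

lemma lexNumber_cons {n m : ℕ} (a : Fin m) (w : Fin n → Fin m) :
    lexNumber (Fin.cons a w : Fin (n + 1) → Fin m) = a * m ^ n + lexNumber w := by
  rw [lexNumber, Fin.sum_univ_succ, lexNumber]
  simp only [Fin.cons_zero, Fin.cons_succ, Fin.val_zero, Fin.val_succ]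
  have : ∀ i : Fin n, n + 1 - 1 - ((i : ℕ) + 1) = n - 1 - i := fun i => by omega
  simp only [this]
  simp
  ring

lemma lexNumber_pos {n m : ℕ} (w : Fin n → Fin m) : 1 ≤ lexNumber w := Nat.le_add_right _ _

lemma lexNumber_le {n m : ℕ} (w : Fin n → Fin m) : lexNumber w ≤ m ^ n := by
  induction n with
  | zero => simp [lexNumber]
  | succ n ih =>
    rw [← Fin.cons_self_tail w, lexNumber_cons, pow_succ']
    have := ih (Fin.tail w)
    have h : ((w 0 : ℕ) + 1) * m ^ n ≤ m * m ^ n := Nat.mul_le_mul_right _ (w 0).2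
    linarith

/-- The indicator function of the initial segment of the lexicographic order with `l` elements. -/
def lexIndicator (n m l : ℕ) (u : Fin n → Fin m) : ℤ := if lexNumber u ≤ l then 1 else 0

lemma ite_mem_lexSegment (n m l : ℕ) (u : Fin n → Fin m) [Decidable (u ∈ lexSegment n m l)] :
    (if u ∈ lexSegment n m l then (1 : ℤ) else 0) = lexIndicator n m l u :=
  if_congr Iff.rfl rfl rfl

lemma lexIndicator_zero (n m : ℕ) (u : Fin n → Fin m) : lexIndicator n m 0 u = 0 :=
  if_neg (by have := lexNumber_pos u; omega)

lemma lexIndicator_cons {n m q r : ℕ} (hr : r ≤ m ^ n) (a : Fin m) (w : Fin n → Fin m) :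
    lexIndicator (n + 1) m (q * m ^ n + r) (Fin.cons a w) =
      if (a : ℕ) < q then 1 else if (a : ℕ) = q then lexIndicator n m r w else 0 := by
  rw [lexIndicator, lexNumber_cons]
  have h0 := lexNumber_pos w
  have h1 := lexNumber_le w
  rcases lt_trichotomy (a : ℕ) q with h | h | h
  · rw [if_pos h, if_pos]
    have : ((a : ℕ) + 1) * m ^ n ≤ q * m ^ n := Nat.mul_le_mul_right _ h
    linarith
  · simp [h, lexIndicator]
  · rw [if_neg h.not_gt, if_neg h.ne', if_neg]
    have : (q + 1) * m ^ n ≤ a * m ^ n := Nat.mul_le_mul_right _ h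
    linarith

lemma sum_fin_lt {m q : ℕ} (hq : q ≤ m) :
    ∑ a : Fin m, (if (a : ℕ) < q then (1 : ℤ) else 0) = q := by
  rw [Fin.sum_univ_eq_sum_range (fun a => if a < q then (1 : ℤ) else 0), Finset.sum_boole]
  have : (Finset.range m).filter (· < q) = Finset.range q := by ext; simp; omega
  simp [this]

lemma sum_fin_le {m q : ℕ} (hq : q ≤ m) :
    ∑ a : Fin m, (if q ≤ (a : ℕ) then (1 : ℤ) else 0) = m - q := by
  have h := sum_fin_lt hq
  have : ∀ a : Fin m, (if q ≤ (a : ℕ) then (1 : ℤ) else 0) =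
      1 - if (a : ℕ) < q then (1 : ℤ) else 0 := by intro a; split_ifs <;> omega
  simp_rw [this, Finset.sum_sub_distrib, h]
  simp

lemma sum_three_way {m q : ℕ} (hq : q < m) (x y : ℤ) :
    ∑ a : Fin m, (if (a : ℕ) < q then x else if (a : ℕ) = q then y else 0) = q * x + y := by
  have : ∀ a : Fin m, (if (a : ℕ) < q then x else if (a : ℕ) = q then y else 0) =
      (if (a : ℕ) < q then 1 else 0) * x + if a = ⟨q, hq⟩ then y else 0 := by
    intro a
    simp only [Fin.ext_iff]
    split_ifs <;> omega
  simp_rw [this, Finset.sum_add_distrib, ← Finset.sum_mul, sum_fin_lt hq.le]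
  simp

lemma sum_lexIndicator_succ {n m q r : ℕ} (hq : q < m) (hr : r ≤ m ^ n) :
    ∑ u, lexIndicator (n + 1) m (q * m ^ n + r) u = q * m ^ n + ∑ w, lexIndicator n m r w := by
  rw [sum_cons]
  simp_rw [lexIndicator_cons hr]
  rw [← sum_three_way hq]
  refine Finset.sum_congr rfl fun a _ => ?_
  split_ifs <;> simp

lemma cutWeight_lexIndicator_succ {n m q r : ℕ} (hq : q < m) (hr : r ≤ m ^ n) :
    cutWeight (n + 1) m (lexIndicator (n + 1) m (q * m ^ n + r)) =
      cutWeight n m (lexIndicator n m r) +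
      ∑ a : Fin m, ∑ b : Fin m, if a = b then 0 else
        (if (a : ℕ) < q then 1 else
          if (a : ℕ) = q then lexIndicator n m r (Function.const _ b) else 0) *
        (1 - if (b : ℕ) < q then 1 else
          if (b : ℕ) = q then lexIndicator n m r (Function.const _ a) else 0) := by
  rw [cutWeight_succ]
  simp_rw [lexIndicator_cons hr]
  congr 1
  have := sum_three_way hq 0 (cutWeight n m (lexIndicator n m r))
  rw [mul_zero, zero_add] at this
  rw [← this]
  refine Finset.sum_congr rfl fun a _ => ?_
  split_ifs <;> simp [cutWeight]

lemma sum_rectangle {m p q : ℕ} (hp : p ≤ m) (hq : q ≤ m) :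
    ∑ a : Fin m, ∑ b : Fin m, (if (a : ℕ) < p ∧ q ≤ (b : ℕ) then (1 : ℤ) else 0) =
      p * (m - q) := by
  rw [← sum_fin_lt hp, ← sum_fin_le hq, Finset.sum_mul_sum]
  refine Finset.sum_congr rfl fun a _ => Finset.sum_congr rfl fun b _ => ?_
  split_ifs <;> simp_all

lemma cutWeight_lexIndicator_mul {n m q : ℕ} (hq : q < m) :
    cutWeight (n + 1) m (lexIndicator (n + 1) m (q * m ^ n)) = q * (m - q) := by
  have h0 : lexIndicator n m 0 = fun _ => 0 := funext fun u => lexIndicator_zero n m u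
  have := cutWeight_lexIndicator_succ (n := n) hq (Nat.zero_le _)
  rw [add_zero] at this
  rw [this, ← sum_rectangle hq.le hq.le, h0]
  rw [show cutWeight n m (fun _ => 0) = 0 by simp [cutWeight], zero_add]
  refine Finset.sum_congr rfl fun a _ => Finset.sum_congr rfl fun b _ => ?_
  have : a = b ↔ (a : ℕ) = b := Fin.ext_iff
  split_ifs <;> first | omega | simp

lemma half_pow_succ_odd {m k : ℕ} (hk : m = 2 * k + 1) (n : ℕ) :
    m ^ (n + 1) / 2 = k * m ^ n + m ^ n / 2 := by
  have : m ^ (n + 1) = 2 * (k * m ^ n) + m ^ n := by rw [pow_succ', hk]; ring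
  omega

lemma half_pow_succ_even {m k : ℕ} (hk : m = 2 * k) (n : ℕ) : m ^ (n + 1) / 2 = k * m ^ n := by
  have : m ^ (n + 1) = 2 * (k * m ^ n) := by rw [pow_succ', hk]; ring
  omega

lemma lexIndicator_half_const {m k : ℕ} (hk : m = 2 * k + 1) (n : ℕ) (b : Fin m) :
    lexIndicator (n + 1) m (m ^ (n + 1) / 2) (Function.const _ b) =
      if (b : ℕ) < k then 1 else 0 := by
  have hconst : ∀ n, Function.const (Fin (n + 1)) b = Fin.cons b (Function.const (Fin n) b) := by
    intro n; funext i; cases i using Fin.cases <;> simp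
  induction n with
  | zero =>
    -- Since `1 / 2 = 0`, the single vertex of the middle block lies outside, so corner `k` is never
    -- included.
    rw [half_pow_succ_odd hk, hconst, lexIndicator_cons (Nat.div_le_self _ _), pow_zero,
      show 1 / 2 = 0 from rfl, lexIndicator_zero, ite_self]
  | succ n ih =>
    rw [half_pow_succ_odd hk, hconst, lexIndicator_cons (Nat.div_le_self _ _), ih]
    split_ifs <;> omega

lemma cutWeight_lexIndicator_half_odd {m k : ℕ} (hk : m = 2 * k + 1) (n : ℕ) :
    cutWeight (n + 1) m (lexIndicator (n + 1) m (m ^ (n + 1) / 2)) = (n + 1) * k ^ 2 + k := by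
  induction n with
  | zero =>
    -- The middle vertex is outside, so `k` full blocks face `k + 1` empty ones; this is the source
    -- of the summand `k`.
    rw [half_pow_succ_odd hk, pow_zero, show 1 / 2 = 0 from rfl, add_zero,
      show k * 1 = k * m ^ 0 by simp, cutWeight_lexIndicator_mul (by omega), hk]
    push_cast; ring
  | succ n ih =>
    rw [half_pow_succ_odd hk, cutWeight_lexIndicator_succ (by omega) (Nat.div_le_self _ _), ih]
    simp_rw [lexIndicator_half_const hk]
    -- The middle block contains exactly its corners facing full blocks, so none of its edges to
    -- other blocks is cut. Only the `k * k` edges between full and empty blocks are new.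
    have := sum_rectangle (m := m) (p := k) (q := k + 1) (by omega) (by omega)
    rw [show ((n + 1 : ℕ) + 1 : ℤ) * k ^ 2 + k = (n + 1) * k ^ 2 + k + k * (m - (k + 1 : ℕ)) by
      rw [hk]; push_cast; ring, ← this]
    congr 1
    refine Finset.sum_congr rfl fun a _ => Finset.sum_congr rfl fun b _ => ?_
    have : a = b ↔ (a : ℕ) = b := Fin.ext_iff
    split_ifs <;> omega

/-! ### Evaluation at half size and conclusion. -/

lemma sum_lexIndicator_half {m : ℕ} (hm : 2 ≤ m) (n : ℕ) :
    ∑ u, lexIndicator n m (m ^ n / 2) u = (m ^ n / 2 : ℕ) := by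
  induction n with
  | zero => simp [lexIndicator_zero]
  | succ n ih =>
    obtain ⟨k, hk | hk⟩ := Nat.even_or_odd' m
    · rw [half_pow_succ_even hk]
      have := sum_lexIndicator_succ (n := n) (m := m) (q := k) (by omega) (Nat.zero_le _)
      rw [add_zero] at this
      rw [this]
      simp [lexIndicator_zero]
    · rw [half_pow_succ_odd hk, sum_lexIndicator_succ (by omega) (Nat.div_le_self _ _), ih]
      push_cast; ring

lemma lexBoundary_half_even {m k : ℕ} (hm : 2 ≤ m) (hk : m = 2 * k) (n : ℕ) :
    lexBoundary m (n + 1) (m ^ (n + 1) / 2 : ℕ) - cornerCount m (n + 1) (m ^ (n + 1) / 2 : ℕ) =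
      k ^ 2 := by
  have h1 := lexBoundary_succ (m := m) (by omega) n (q := k) le_rfl (by positivity) (by omega)
    (.inr rfl)
  have h2 := cornerCount_succ (m := m) (by omega) n (q := k) (by omega) le_rfl (by positivity)
    (.inr rfl)
  rw [add_zero, lexBoundary_zero, cornerCount_zero, min_eq_right (by omega)] at h1
  rw [add_zero, cornerCount_zero, if_neg (by omega)] at h2
  rw [half_pow_succ_even hk]
  push_cast
  rw [h1, h2, hk]
  push_cast; ring

lemma lexBoundary_half_odd {m k : ℕ} (hm : 2 ≤ m) (hk : m = 2 * k + 1) (n : ℕ) :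
    cornerCount m (n + 1) (m ^ (n + 1) / 2 : ℕ) = k ∧
    lexBoundary m (n + 1) (m ^ (n + 1) / 2 : ℕ) - cornerCount m (n + 1) (m ^ (n + 1) / 2 : ℕ) =
      (n + 1) * k ^ 2 + k := by
  have hle : ∀ n, ((m ^ n / 2 : ℕ) : ℤ) ≤ (m : ℤ) ^ n := fun n => by
    exact_mod_cast Nat.div_le_self _ _
  have hsucc : ∀ n, ((m ^ (n + 1) / 2 : ℕ) : ℤ) = k * (m : ℤ) ^ n + (m ^ n / 2 : ℕ) := fun n => by
    rw [half_pow_succ_odd hk]; push_cast; ring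
  have h1 := fun n => lexBoundary_succ (m := m) (by omega) n (q := k) (by omega) (hle n)
    (by omega) (.inl (by omega))
  have h2 := fun n => cornerCount_succ (m := m) (by omega) n (q := k) (by omega) (by omega) (hle n)
    (.inl (by omega))
  simp_rw [← hsucc] at h1 h2
  have hmul : (k : ℤ) * (m + 1 - k) = k ^ 2 + 2 * k := by rw [hk]; push_cast; ring
  induction n with
  | zero =>
    rw [h1, h2, hmul]
    rw [show m ^ 0 / 2 = 0 by simp, Nat.cast_zero, lexBoundary_zero, cornerCount_zero,
      min_eq_right (by omega), if_neg (by omega)]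
    constructor <;> push_cast <;> ring
  | succ n ih =>
    rw [h1, h2, hmul, ih.1, if_neg (by omega), min_self]
    refine ⟨by ring, ?_⟩
    have := ih.2
    rw [ih.1] at this
    rw [Nat.cast_succ n]
    linarith

open Classical in
lemma ncard_edgeBoundary_ge_of_isBisection {n m : ℕ} (hm : 2 ≤ m) {S : Set (Fin n → Fin m)}
    (hS : IsBisection S) :
    lexBoundary m n (m ^ n / 2 : ℕ) - cornerCount m n (m ^ n / 2 : ℕ) ≤
      (edgeBoundary (sierpinskiGraph n m) S).ncard := by
  have hm' : (0 : ℤ) < m := by omega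
  -- Prescribing for each corner its actual side makes the penalty zero.
  have h := terminalCost_le (by omega) n (fun u => if u ∈ S then (1 : ℤ) else 0)
    (fun u => by split_ifs <;> simp) (fun c => if Function.const _ c ∈ S then (1 : ℤ) else 0)
    (fun c => by split_ifs <;> simp)
  rw [← ncard_eq_sum] at h
  simp only [sub_self, abs_zero, Finset.sum_const_zero, add_zero] at h
  rw [cutWeight, ← ncard_edgeBoundary] at h
  refine le_trans ?_ h
  have hcard := Set.ncard_add_ncard_compl S
  rw [Nat.card_eq_fintype_card, Fintype.card_fun, Fintype.card_fin, Fintype.card_fin] at hcard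
  obtain ⟨hS1, hS2⟩ := hS
  have habs := abs_nonneg (∑ c, (if Function.const (Fin n) c ∈ S then (1 : ℤ) else 0) -
    cornerCount m n S.ncard)
  rw [terminalCost]
  have hle : ((m ^ n / 2 : ℕ) : ℤ) ≤ (m : ℤ) ^ n := by exact_mod_cast Nat.div_le_self _ _
  -- For odd `m ^ n` the set may be the larger half; `lexBoundary - cornerCount` is invariant under
  -- complement.
  rcases (by omega : S.ncard = m ^ n / 2 ∨ S.ncard = m ^ n - m ^ n / 2) with e | e
  · rw [e] at habs ⊢
    linarith
  · have e' : (S.ncard : ℤ) = (m : ℤ) ^ n - (m ^ n / 2 : ℕ) := by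
      rw [e, Nat.cast_sub (Nat.div_le_self _ _)]; push_cast; ring
    have h1 := lexBoundary_complement hm' n (l := (m ^ n / 2 : ℕ)) (by omega) hle
    have h2 := cornerCount_complement hm' n (l := (m ^ n / 2 : ℕ)) (by omega) hle
    rw [← e'] at h1 h2
    linarith

lemma isBisection_lexSegment {n m : ℕ} (hm : 2 ≤ m) :
    IsBisection (lexSegment n m (m ^ n / 2)) := by
  classical
  have h := sum_lexIndicator_half hm n
  have h1 : ((lexSegment n m (m ^ n / 2)).ncard : ℤ) = (m ^ n / 2 : ℕ) := by
    rw [← h, ncard_eq_sum]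
    exact Finset.sum_congr rfl fun u _ => ite_mem_lexSegment n m _ u
  have hcard := Set.ncard_add_ncard_compl (lexSegment n m (m ^ n / 2))
  rw [Nat.card_eq_fintype_card, Fintype.card_fun, Fintype.card_fin, Fintype.card_fin] at hcard
  unfold IsBisection
  omega

lemma ncard_edgeBoundary_lexSegment (n m l : ℕ) :
    ((edgeBoundary (sierpinskiGraph n m) (lexSegment n m l)).ncard : ℤ) =
      cutWeight n m (lexIndicator n m l) := by
  classical
  rw [ncard_edgeBoundary, cutWeight]
  refine Finset.sum_congr rfl fun u _ => Finset.sum_congr rfl fun v _ => ?_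
  simp only [ite_mem_lexSegment]

theorem mainTheorem5 (n m : ℕ) (hn : 1 ≤ n) (hm : 2 ≤ m) :
    bisectionWidth (sierpinskiGraph n m) =
        (if Even m then m ^ 2 / 4 else n * (m / 2) ^ 2 + m / 2) ∧
      bisectionWidth (sierpinskiGraph n m) =
        (edgeBoundary (sierpinskiGraph n m) (lexSegment n m (m ^ n / 2))).ncard := by
  obtain ⟨n, rfl⟩ := Nat.exists_eq_add_of_le' hn
  set L := lexSegment (n + 1) m (m ^ (n + 1) / 2) with hL
  have hvalue : (edgeBoundary (sierpinskiGraph (n + 1) m) L).ncard =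
      (if Even m then m ^ 2 / 4 else (n + 1) * (m / 2) ^ 2 + m / 2) ∧
      ((edgeBoundary (sierpinskiGraph (n + 1) m) L).ncard : ℤ) =
        lexBoundary m (n + 1) (m ^ (n + 1) / 2 : ℕ) -
          cornerCount m (n + 1) (m ^ (n + 1) / 2 : ℕ) := by
    have hcut := ncard_edgeBoundary_lexSegment (n + 1) m (m ^ (n + 1) / 2)
    rw [← hL] at hcut
    obtain ⟨k, hk | hk⟩ := Nat.even_or_odd' m
    · rw [half_pow_succ_even hk, cutWeight_lexIndicator_mul (by omega)] at hcut
      have hsq : (k : ℤ) * (m - k) = k ^ 2 := by rw [hk]; push_cast; ring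
      rw [lexBoundary_half_even hm hk, hcut, hsq, if_pos ⟨k, by omega⟩]
      refine ⟨?_, rfl⟩
      rw [hsq] at hcut
      have : m ^ 2 = 4 * k ^ 2 := by rw [hk]; ring
      rw [this, Nat.mul_div_cancel_left _ (by norm_num)]
      exact_mod_cast hcut
    · rw [cutWeight_lexIndicator_half_odd hk] at hcut
      rw [(lexBoundary_half_odd hm hk n).2, hcut,
        if_neg (Nat.not_even_iff_odd.2 ⟨k, hk⟩)]
      refine ⟨?_, rfl⟩
      rw [show m / 2 = k by omega]
      exact_mod_cast hcut
  have hwidth : bisectionWidth (sierpinskiGraph (n + 1) m) =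
      (edgeBoundary (sierpinskiGraph (n + 1) m) L).ncard := by
    refine le_antisymm (Nat.sInf_le ⟨L, isBisection_lexSegment hm, rfl⟩)
      (le_csInf ⟨_, L, isBisection_lexSegment hm, rfl⟩ ?_)
    rintro _ ⟨S, hS, rfl⟩
    have := ncard_edgeBoundary_ge_of_isBisection hm hS
    rw [← hvalue.2] at this
    exact_mod_cast this
  exact ⟨hwidth.trans hvalue.1, hwidth⟩
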